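/- Let $G$ be a finite simple graph and $r\ge 3$ an integer. For a vertex $v$ of $G$, the ball $B_{r/2}(v)$ is the subgraph of $G$ consisting of all vertices at distance at most $r/2$ from $v$ and all edges $xy$ of $G$ with $d_G(v,x)+d_G(v,y)<r$. Suppose that $G$ is $r$-locally chordal, i.e. every ball $B_{r/2}(v)$ is chordal (each of its cycles of length at least four has a chord). Let $K(G)$ be the set of inclusion-wise maximal cliques of $G$, let $K_G(v)$ be the set of those containing the vertex $v$, and let $\mathbf K(G)$ be the graph with vertex set $K(G)$ in which distinct $K_1,K_2$ are adjacent if $K_1\cap K_2\neq\emptyset$; the edge $K_1K_2$ has weight $|K_1\cap K_2|$, and the weight of a subgraph of $\mathbf K(G)$ is the sum of the weights of its edges. For a spanning subgraph $H$ of $\mathbf K(G)$ put $H_v:=H[K_G(v)]$ for $v\in V(G)$. For an integer $s \ge 0$, call $H$ $s$-acyclic if for every set $X$ of at most $s$ vertices of $G$ the union $\bigcup_{v\in X}H_v$ contains no cycle. Call $H$ a clique graph of $G$ if $v\mapsto H_v$ is a region representation of $G$ over $H$, i.e. every $H_v$ is nonempty and connected, and any two distinct vertices $u,v$ are adjacent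 in $G$ if and only if $H_u$ and $H_v$ have a common vertex. Then for every subgraph $H$ of $\mathbf K(G)$ the following are equivalent: 1. $H$ is a spanning subgraph of $\mathbf K(G)$ that is an $r$-acyclic clique graph of $G$. 2. $H$ is a $2$-acyclic spanning subgraph of $\mathbf K(G)$ whose weight is maximum among all $2$-acyclic spanning subgraphs of $\mathbf K(G)$. 3. $H$ is a $2$-acyclic spanning subgraph of $\mathbf K(G)$ of weight $\left(\sum_{K\in K(G)}|K|\right)-|V(G)|$. -/

import Mathlib

namespace LocChordal

open SimpleGraph

/-- A graph is chordal if every cycle of length at least four has a chord: an edge of the graph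
between two vertices of the cycle which is not an edge of the cycle. -/
def IsChordal {V : Type*} (G : SimpleGraph V) : Prop :=
  ∀ (v : V) (c : G.Walk v v), c.IsCycle → 4 ≤ c.length →
    ∃ x ∈ c.support, ∃ y ∈ c.support, G.Adj x y ∧ s(x, y) ∉ c.edges

/-- The ball of radius `r / 2` around `v`: the vertices at distance at most `r / 2` from `v`, with
those edges of `G` for which the sum of the distances of the two ends to `v` is less than `r`.
Distances are extended distances, so that vertices in other components are at distance `⊤`. -/
def halfBall {V : Type*} (G : SimpleGraph V) (v : V) (r : ℕ) : G.Subgraph where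
  verts := {u | 2 * G.edist v u ≤ (r : ℕ∞)}
  Adj a b := G.Adj a b ∧ G.edist v a + G.edist v b < (r : ℕ∞)
  adj_sub h := h.1
  edge_vert := by
    rintro a b ⟨hab, hlt⟩
    have h1 : G.edist v a ≤ G.edist v b + 1 :=
      (SimpleGraph.edist_triangle (v := b)).trans
        (add_le_add le_rfl (G.edist_le_one_iff_adj_or_eq.2 (Or.inl hab.symm)))
    have h2 : 2 * G.edist v a ≤ G.edist v a + G.edist v b + 1 := by
      rw [two_mul, add_assoc]
      exact add_le_add le_rfl h1
    exact h2.trans (Order.add_one_le_of_lt hlt)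
  symm := ⟨fun a b h => ⟨h.1.symm, by rw [add_comm]; exact h.2⟩⟩

/-- A graph is `r`-locally chordal if all its balls of radius `r / 2` are chordal. -/
def IsLocallyChordal {V : Type*} (G : SimpleGraph V) (r : ℕ) : Prop :=
  ∀ v : V, IsChordal (halfBall G v r).coe

/-- The type of all inclusion-wise maximal cliques of `G`. -/
abbrev MaxClique {V : Type*} (G : SimpleGraph V) : Type _ :=
  {K : Set V // Maximal G.IsClique K}

/-- The intersection graph of the maximal cliques of `G`. -/
def cliqueIntersectionGraph {V : Type*} (G : SimpleGraph V) : SimpleGraph (MaxClique G) where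
  Adj K L := K ≠ L ∧ (K.1 ∩ L.1).Nonempty
  symm := ⟨fun K L h => ⟨h.1.symm, by rw [Set.inter_comm]; exact h.2⟩⟩
  loopless := ⟨fun _ h => h.1 rfl⟩

/-- The set of all maximal cliques of `G` that contain `v`. -/
def cliquesThrough {V : Type*} (G : SimpleGraph V) (v : V) : Set (MaxClique G) :=
  {K | v ∈ K.1}

/-- For a spanning subgraph `H` of the intersection graph of the maximal cliques, the subgraph of
`H` induced on the set of all maximal cliques containing `v`. -/
def coPart {V : Type*} (G : SimpleGraph V) (H : (cliqueIntersectionGraph G).Subgraph) (v : V) :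
    (cliqueIntersectionGraph G).Subgraph :=
  H.induce (cliquesThrough G v)

/-- A family of subgraphs is `r`-acyclic if every union of at most `r` of its members is acyclic. -/
def IsAcyclicFamily {V W : Type*} {Γ : SimpleGraph W} (F : V → Γ.Subgraph) (r : ℕ) : Prop :=
  ∀ X : Finset V, X.card ≤ r → (⨆ v ∈ X, F v).coe.IsAcyclic

/-- The map `v ↦ F v` is a region representation of `G` over the subgraph `H` of `Γ`: every `F v`
is a (nonempty) connected subgraph of `H`, and two distinct vertices are adjacent in `G` exactly
when their regions share a vertex. -/
structure IsRegionRepresentation {V W : Type*} (G : SimpleGraph V) {Γ : SimpleGraph W}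
    (H : Γ.Subgraph) (F : V → Γ.Subgraph) : Prop where
  le : ∀ v, F v ≤ H
  connected : ∀ v, (F v).Connected
  adj_iff : ∀ u v, u ≠ v → (G.Adj u v ↔ ((F u).verts ∩ (F v).verts).Nonempty)

/-- A clique graph of `G` is a spanning subgraph `H` of the intersection graph of the maximal
cliques for which the induced subgraphs on the maximal cliques through the single vertices form a
region representation of `G` over `H`. -/
def IsCliqueGraph {V : Type*} (G : SimpleGraph V)
    (H : (cliqueIntersectionGraph G).Subgraph) : Prop :=
  H.IsSpanning ∧ IsRegionRepresentation G H (coPart G H)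

/-- A clique graph whose corresponding region representation is `r`-acyclic. -/
def IsAcyclicCliqueGraph {V : Type*} (G : SimpleGraph V) (r : ℕ)
    (H : (cliqueIntersectionGraph G).Subgraph) : Prop :=
  IsCliqueGraph G H ∧ IsAcyclicFamily (coPart G H) r

/-- An `r`-acyclic spanning subgraph of the intersection graph of the maximal cliques. -/
def IsAcyclicSpanning {V : Type*} (G : SimpleGraph V) (r : ℕ)
    (H : (cliqueIntersectionGraph G).Subgraph) : Prop :=
  H.IsSpanning ∧ IsAcyclicFamily (coPart G H) r

/-- The weight `|K ∩ L|` of an edge `KL` of the intersection graph of the maximal cliques. -/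
noncomputable def edgeWeight {V : Type*} (G : SimpleGraph V) : Sym2 (MaxClique G) → ℕ :=
  Sym2.lift ⟨fun K L => (K.1 ∩ L.1).ncard, fun K L => congrArg Set.ncard (Set.inter_comm K.1 L.1)⟩

/-- The total weight of a subgraph, used for finite `G`: the sum of the weights of its edges. -/
noncomputable def totalWeight {V : Type*} (G : SimpleGraph V)
    (H : (cliqueIntersectionGraph G).Subgraph) : ℕ :=
  ∑ᶠ e ∈ H.edgeSet, edgeWeight G e

/-- An `r`-acyclic spanning subgraph that has maximum total weight among all `r`-acyclic spanning
subgraphs of the intersection graph of the maximal cliques. -/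
def IsMaxWeightAcyclicSpanning {V : Type*} (G : SimpleGraph V) (r : ℕ)
    (H : (cliqueIntersectionGraph G).Subgraph) : Prop :=
  IsAcyclicSpanning G r H ∧
    ∀ H' : (cliqueIntersectionGraph G).Subgraph,
      IsAcyclicSpanning G r H' → totalWeight G H' ≤ totalWeight G H

end LocChordal

/-! An edge KL of H lies in H_v exactly when v ∈ K ∩ L, so the weight of H is the sum over v of the
numbers of edges of the H_v. If H is 2-acyclic, each H_v is a forest on the nonempty set K_G(v), so
it has at most |K_G(v)| - 1 edges, with equality iff it is connected. Summing over v bounds the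
weight by Σ|K| - |V|, with equality iff all H_v are connected (`totalWeight_add_card`), which for
spanning H means being a clique graph (`isCliqueGraph_iff`). Two facts remain.

The bound is attained (`exists_isAcyclicSpanning`). Closed neighbourhoods are chordal, so K_G(v)
carries a forest that is connected on every K_G(v) ∩ K_G(x). Such trees can be exchanged on
overlaps; minimising one additive injective code makes them agree there. Their union H has them as
its parts H_v, and two trees sharing a connected overlap have an acyclic union.

With connected parts, 2-acyclic implies r-acyclic (`isAcyclicFamily_coPart`). A cycle of length at
most r lies in the ball around any of its vertices, so at most r vertices induce a chordal graph.
Eliminating simplicial vertices x, the Helly property of cliques shows that any two vertices shared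
by H_x and the union of the remaining parts are joined inside both. -/

namespace LocChordal

open SimpleGraph

variable {V W : Type*}

/-! ### Connectivity on vertex sets and acyclicity of unions -/

/-- The edges of `T` with both ends in `P`, as a graph on all vertices. -/
def within (T : SimpleGraph W) (P : Set W) : SimpleGraph W where
  Adj a b := T.Adj a b ∧ a ∈ P ∧ b ∈ P
  symm := ⟨fun _ _ h => ⟨h.1.symm, h.2.2, h.2.1⟩⟩
  loopless := ⟨fun _ h => h.1.ne rfl⟩

theorem within_le (T : SimpleGraph W) (P : Set W) : within T P ≤ T := fun _ _ h => h.1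

theorem within_mono {S T : SimpleGraph W} {P Q : Set W}
    (h : ∀ a b, a ∈ P → b ∈ P → S.Adj a b → T.Adj a b) (hPQ : P ⊆ Q) :
    within S P ≤ within T Q :=
  fun a b hab => ⟨h a b hab.2.1 hab.2.2 hab.1, hPQ hab.2.1, hPQ hab.2.2⟩

theorem mem_of_mem_support_within {T : SimpleGraph W} {P : Set W} {a b : W}
    (p : (within T P).Walk a b) (ha : a ∈ P) : ∀ x ∈ p.support, x ∈ P := by
  induction p with
  | nil => simpa using ha
  | cons h p ih =>
    intro x hx
    rcases List.mem_cons.1 (by simpa using hx) with rfl | hx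
    · exact ha
    · exact ih h.2.2 x hx

/-- Any two vertices of `P` are joined by a walk of `T` inside `P`. -/
def ConnOn (T : SimpleGraph W) (P : Set W) : Prop :=
  ∀ a ∈ P, ∀ b ∈ P, (within T P).Reachable a b

theorem reachable_of_forall_adj {S T : SimpleGraph W}
    (h : ∀ a b, S.Adj a b → T.Reachable a b) {a b : W} (hab : S.Reachable a b) :
    T.Reachable a b := by
  obtain ⟨p⟩ := hab
  induction p with
  | nil => exact Reachable.refl _
  | cons hadj _ ih => exact (h _ _ hadj).trans ih

theorem ConnOn.mono {S T : SimpleGraph W} {P : Set W} (hS : ConnOn S P)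
    (h : ∀ a b, a ∈ P → b ∈ P → S.Adj a b → T.Adj a b) : ConnOn T P := fun a ha b hb =>
  (hS a ha b hb).mono (within_mono h subset_rfl)

/-- Paths in a forest are unique, so the path inside `P` and the path inside `Q` coincide. -/
theorem ConnOn.inter {T : SimpleGraph W} (hT : T.IsAcyclic) {P Q : Set W} (hP : ConnOn T P)
    (hQ : ConnOn T Q) : ConnOn T (P ∩ Q) := by
  classical
  intro a ha b hb
  obtain ⟨p, hp⟩ := (hP a ha.1 b hb.1).exists_isPath
  obtain ⟨q, hq⟩ := (hQ a ha.2 b hb.2).exists_isPath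
  have e : (p.mapLe (within_le T P)) = q.mapLe (within_le T Q) :=
    congrArg Subtype.val ((hT.subsingleton_path a b).elim ⟨_, hp.mapLe (within_le T P)⟩
      ⟨_, hq.mapLe (within_le T Q)⟩)
  have e' : p.edges = q.edges := by
    have := congrArg Walk.edges e
    simpa using this
  refine ⟨p.transfer _ fun e he => ?_⟩
  have h1 := p.edges_subset_edgeSet he
  have h2 := q.edges_subset_edgeSet (e' ▸ he)
  induction e with
  | h x y => exact ⟨h1.1, ⟨h1.2.1, h2.2.1⟩, ⟨h1.2.2, h2.2.2⟩⟩

/-- A walk in `A ⊔ B` between vertices of `SB`, where the parts in `A` can be replaced. -/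
theorem reachable_of_reachable_sup {A B : SimpleGraph W} {SA SB : Set W}
    (hA : ∀ a b, A.Adj a b → a ∈ SA ∧ b ∈ SA) (hB : ∀ a b, B.Adj a b → a ∈ SB ∧ b ∈ SB)
    (h : ∀ s ∈ SA ∩ SB, ∀ t ∈ SA ∩ SB, B.Reachable s t) {x y : W} (hx : x ∈ SB) (hy : y ∈ SB)
    (hxy : (A ⊔ B).Reachable x y) : B.Reachable x y := by
  obtain ⟨p⟩ := hxy
  -- The second clause carries the induction through stretches in `A`: such a stretch may be resumed
  -- from any shared vertex, as these are all joined in `B`.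
  suffices key : (x ∈ SB → B.Reachable x y) ∧
      (x ∈ SA → ∀ s ∈ SA ∩ SB, B.Reachable s y) from key.1 hx
  clear hx
  induction p with
  | nil => exact ⟨fun _ => Reachable.refl _, fun ha s hs => h s hs _ ⟨ha, hy⟩⟩
  | cons hadj _ ih =>
    have ih := ih hy
    rcases hadj with hadj | hadj
    · obtain ⟨h1, h2⟩ := hA _ _ hadj
      exact ⟨fun hb => ih.2 h2 _ ⟨h1, hb⟩, fun _ => ih.2 h2⟩
    · obtain ⟨h1, h2⟩ := hB _ _ hadj
      have := hadj.reachable.trans (ih.1 h2)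
      exact ⟨fun _ => this, fun ha s hs => (h s hs _ ⟨ha, h1⟩).trans this⟩

/-- Edges of `B \ D` can be added to `A` without closing a cycle. If `x` and `y` were already
joined, replacing the parts in `A` by walks in `D` would join them in `B` minus the edge `xy`, but
that edge is a bridge of the forest `B`. -/
theorem isAcyclic_sup_sdiff [Finite W] {A B D : SimpleGraph W} {SA SB : Set W} (hAc : A.IsAcyclic)
    (hBc : B.IsAcyclic) (hA : ∀ a b, A.Adj a b → a ∈ SA ∧ b ∈ SA)
    (hB : ∀ a b, B.Adj a b → a ∈ SB ∧ b ∈ SB) (hD : D ≤ B)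
    (h : ∀ s ∈ SA ∩ SB, ∀ t ∈ SA ∩ SB, D.Reachable s t) : (A ⊔ (B \ D)).IsAcyclic := by
  obtain ⟨F, hF⟩ :=
    (Set.toFinite {F : SimpleGraph W | F ≤ B \ D ∧ (A ⊔ F).IsAcyclic}).exists_maximal
    ⟨⊥, bot_le, by simpa using hAc⟩
  suffices hle : B \ D ≤ F by
    rw [le_antisymm hle hF.prop.1]; exact hF.prop.2
  intro x y hxy
  by_contra hn
  have hxyB : B.Adj x y := hxy.1
  have hle : D ⊔ F ≤ B.deleteEdges {s(x, y)} := by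
    intro a b hab
    have hab' : B.Adj a b := hab.elim (fun t => hD t) (fun t => (hF.prop.1 t).1)
    rw [deleteEdges_adj]
    refine ⟨hab', fun he => ?_⟩
    have he : s(a, b) = s(x, y) := he
    have : (D ⊔ F).Adj x y := by
      rw [← mem_edgeSet, ← he]; exact hab
    exact this.elim hxy.2 hn
  have hnr : ¬ (A ⊔ F).Reachable x y := by
    intro hr
    have h1 : (D ⊔ F).Reachable x y := by
      refine reachable_of_reachable_sup (A := A) (SA := SA) (SB := SB) hA
        (fun a b hab => hB a b ?_) (fun s hs t ht => (h s hs t ht).mono le_sup_left)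
        (hB _ _ hxyB).1 (hB _ _ hxyB).2 (hr.mono (sup_le_sup_left le_sup_right A))
      exact hab.elim (fun t => hD t) (fun t => (hF.prop.1 t).1)
    exact isAcyclic_iff_forall_adj_isBridge.1 hBc hxyB (h1.mono hle)
  have hac := hF.prop.2.sup_edge_of_not_reachable hnr
  have hmem : F ⊔ edge x y ≤ B \ D := sup_le hF.prop.1 (by
    rw [edge_le_iff]; exact Or.inr hxy)
  have := hF.le_of_ge ⟨hmem, by rwa [← sup_assoc]⟩ le_sup_left
  exact hn (this (Or.inr (by simp [edge_adj, hxyB.ne])))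

theorem isAcyclic_sup [Finite W] {A B : SimpleGraph W} {SA SB : Set W} (hAc : A.IsAcyclic)
    (hBc : B.IsAcyclic) (hA : ∀ a b, A.Adj a b → a ∈ SA ∧ b ∈ SA)
    (hB : ∀ a b, B.Adj a b → a ∈ SB ∧ b ∈ SB)
    (h : ∀ s ∈ SA ∩ SB, ∀ t ∈ SA ∩ SB, (A ⊓ B).Reachable s t) : (A ⊔ B).IsAcyclic := by
  have := isAcyclic_sup_sdiff hAc hBc hA hB inf_le_right h
  rwa [sdiff_inf_self_right, sup_sdiff_self] at this

/-! ### Chordality and simplicial vertices -/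

/-- Every cycle of length at least four inside `A` has a chord. -/
def ChordalOn (G : SimpleGraph V) (A : Set V) : Prop :=
  ∀ (v : V) (c : G.Walk v v), c.IsCycle → 4 ≤ c.length → (∀ x ∈ c.support, x ∈ A) →
    ∃ x ∈ c.support, ∃ y ∈ c.support, G.Adj x y ∧ s(x, y) ∉ c.edges

theorem ChordalOn.mono {G : SimpleGraph V} {A B : Set V} (h : ChordalOn G B) (hAB : A ⊆ B) :
    ChordalOn G A := fun v c hc hl hs => h v c hc hl fun x hx => hAB (hs x hx)

/-- Shortest walks are induced: the section between two adjacent vertices is itself shortest, hence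
a single edge. -/
theorem mem_edges_of_length_eq_dist {G : SimpleGraph V} {u v : V} {p : G.Walk u v}
    (hp : p.length = G.dist u v) {x y : V} (hx : x ∈ p.support) (hy : y ∈ p.support)
    (hxy : G.Adj x y) : s(x, y) ∈ p.edges := by
  classical
  have aux : ∀ {a b : V} (q : G.Walk a b), q.IsSubwalk p → G.Adj a b → s(a, b) ∈ p.edges := by
    intro a b q hq hab
    have hl := length_eq_dist_of_subwalk hp hq
    rw [dist_eq_one_iff_adj.2 hab] at hl
    apply hq.edges_subset
    cases q with
    | nil => simp at hl
    | cons h q =>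
      cases q with
      | nil => simp
      | cons => simp at hl
  by_cases h : y ∈ (p.dropUntil x hx).support
  · exact aux _ ((Walk.isSubwalk_takeUntil _ h).trans (p.isSubwalk_dropUntil hx)) hxy
  · have h' : y ∈ (p.takeUntil x hx).support := by
      have := p.take_spec hx
      rw [← this, Walk.mem_support_append_iff] at hy
      exact hy.resolve_right h
    rw [Sym2.eq_swap]
    exact aux _ ((Walk.isSubwalk_dropUntil _ h').trans (p.isSubwalk_takeUntil hx)) hxy.symm

/-- Otherwise a shortest path from `y` to `z` through `C`, closed up via `d`, is a cycle of length
at least four without a chord: the path is induced, and `d` sees nothing of `C`. -/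
theorem ChordalOn.adj_of_connOn {G : SimpleGraph V} {A C : Set V} (hA : ChordalOn G A)
    (hC : C ⊆ A) (hconn : ConnOn G C) {y z d : V} (hyA : y ∈ A) (hzA : z ∈ A) (hdA : d ∈ A)
    (hyC : ∃ c ∈ C, G.Adj c y) (hzC : ∃ c ∈ C, G.Adj c z) (hdC : d ∉ C)
    (hd : ∀ c ∈ C, ¬ G.Adj c d) (hyd : G.Adj y d) (hzd : G.Adj z d) (hyz : y ≠ z) :
    G.Adj y z := by
  by_contra hn
  set S : Set V := C ∪ {y, z} with hS
  obtain ⟨c, hc, hcy⟩ := hyC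
  obtain ⟨c', hc', hcz⟩ := hzC
  have hr : (within G S).Reachable y z := by
    have h1 : (within G S).Adj y c := ⟨hcy.symm, by simp [hS], by simp [hS, hc]⟩
    have h2 : (within G S).Adj c' z := ⟨hcz, by simp [hS, hc'], by simp [hS]⟩
    refine (h1.reachable.trans ?_).trans h2.reachable
    exact (hconn c hc c' hc').mono (within_mono (fun _ _ _ _ h => h) Set.subset_union_left)
  obtain ⟨p, hp, hlen⟩ := hr.exists_path_of_dist
  have hsup : ∀ x ∈ p.support, x ∈ S := mem_of_mem_support_within p (by simp [hS])
  have hdS : d ∉ S := by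
    simp only [hS, Set.mem_union, Set.mem_insert_iff, Set.mem_singleton_iff, not_or]
    exact ⟨hdC, hyd.ne', hzd.ne'⟩
  set q : G.Walk y z := p.mapLe (within_le G S) with hq
  have hqs : q.support = p.support := by simp [hq]
  have hqe : q.edges = p.edges := by simp [hq]
  have hql : q.length = p.length := by simp [hq]
  have hqp : q.IsPath := hp.mapLe _
  have hdq : d ∉ q.support := fun h => hdS (hsup d (hqs ▸ h))
  have h2 : 2 ≤ p.length := by
    by_contra hlt
    have : p.length = 0 ∨ p.length = 1 := by omega
    rcases this with h | h
    · exact hyz (Walk.eq_of_length_eq_zero h)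
    · exact hn (Walk.adj_of_length_eq_one h).1
  set w : G.Walk d d := Walk.cons hyd.symm (q.concat hzd) with hw
  have hcyc : w.IsCycle := by
    rw [hw, Walk.cons_isCycle_iff]
    refine ⟨hqp.concat hdq hzd, fun he => ?_⟩
    rw [Walk.edges_concat, List.concat_eq_append, List.mem_append, List.mem_singleton] at he
    rcases he with he | he
    · exact hdq (Walk.fst_mem_support_of_mem_edges _ he)
    · rw [Sym2.eq_swap, Sym2.congr_left] at he
      exact hyz he
  have hws : ∀ x ∈ w.support, x = d ∨ x ∈ p.support := by
    intro x hx
    have hx : x = d ∨ x ∈ q.support ∨ x = d := by simpa [hw, Walk.support_concat] using hx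
    rw [hqs] at hx
    tauto
  obtain ⟨a, ha, b, hb, hab, hnot⟩ := hA d w hcyc (by simp [hw, hql]; omega) (by
    intro x hx
    rcases hws x hx with rfl | hx'
    · exact hdA
    · rcases hsup x hx' with h | h | h
      · exact hC h
      · exact h ▸ hyA
      · exact h ▸ hzA)
  have hwe : ∀ e, e ∈ w.edges ↔ e = s(d, y) ∨ e ∈ p.edges ∨ e = s(z, d) := by
    intro e; simp [hw, hqe, Walk.edges_concat]
  have hdn : ∀ x ∈ p.support, G.Adj x d → s(d, x) ∈ w.edges := by
    intro x hx hxd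
    rw [hwe]
    rcases hsup x hx with h | h | h
    · exact absurd hxd (hd x h)
    · exact Or.inl (h ▸ rfl)
    · exact Or.inr (Or.inr (by rw [Sym2.eq_swap]; exact h ▸ rfl))
  rcases hws a ha with rfl | ha'
  · rcases hws b hb with rfl | hb'
    · exact hab.ne rfl
    · exact hnot (hdn b hb' hab.symm)
  · rcases hws b hb with rfl | hb'
    · exact hnot (Sym2.eq_swap ▸ hdn a ha' hab)
    · refine hnot ((hwe _).2 (Or.inr (Or.inl ?_)))
      exact mem_edges_of_length_eq_dist hlen ha' hb' ⟨hab, hsup a ha', hsup b hb'⟩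

/-- Dirac's argument. Take a largest connected `C` that misses some vertex and all its neighbours;
`D` collects the vertices outside `C` with no neighbour in `C`. A simplicial vertex of `D` stays
simplicial in `A`, because its further neighbours are attached to `C`, complete to `D` and pairwise
adjacent. -/
theorem exists_simplicial {G : SimpleGraph V} (A : Finset V) (hne : A.Nonempty)
    (hA : ChordalOn G A) : ∃ x ∈ A, G.IsClique {y | y ∈ A ∧ G.Adj x y} := by
  classical
  induction A using Finset.strongInduction with
  | H A ih =>
  by_cases hcl : ∀ x ∈ A, ∀ y ∈ A, x ≠ y → G.Adj x y
  · obtain ⟨x, hx⟩ := hne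
    exact ⟨x, hx, fun a ha b hb hab => hcl a ha.1 b hb.1 hab⟩
  push Not at hcl
  obtain ⟨v, hv, w, hw, hvw, hnadj⟩ := hcl
  let P : Finset V → Prop := fun C => C.Nonempty ∧ ConnOn G (C : Set V) ∧
    ∃ d ∈ A, d ∉ C ∧ ∀ c ∈ C, ¬ G.Adj c d
  have hPv : {v} ∈ A.powerset.filter P := by
    simp only [Finset.mem_filter, Finset.mem_powerset, Finset.singleton_subset_iff]
    refine ⟨hv, Finset.singleton_nonempty v, ?_, w, hw, by simpa using hvw.symm,
      by simpa using hnadj⟩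
    intro a ha b hb
    simp only [Finset.coe_singleton, Set.mem_singleton_iff] at ha hb
    subst ha; subst hb; rfl
  obtain ⟨C, hCm, hmax⟩ := Finset.exists_max_image (A.powerset.filter P) Finset.card ⟨_, hPv⟩
  simp only [Finset.mem_filter, Finset.mem_powerset] at hCm
  obtain ⟨hCA, hCne, hCconn, d₀, hd₀A, hd₀C, hd₀⟩ := hCm
  set D := A.filter (fun d => d ∉ C ∧ ∀ c ∈ C, ¬ G.Adj c d) with hD
  -- If `y` missed `d`, then `insert y C` would contradict the maximality of `C`.
  have hND : ∀ y ∈ A, (∃ c ∈ C, G.Adj c y) → ∀ d ∈ D, y ∉ C → G.Adj y d := by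
    rintro y hy ⟨c, hc, hcy⟩ d hd hyC
    by_contra hn
    simp only [hD, Finset.mem_filter] at hd
    have hm : insert y C ∈ A.powerset.filter P := by
      simp only [Finset.mem_filter, Finset.mem_powerset, Finset.insert_subset_iff]
      refine ⟨⟨hy, hCA⟩, Finset.insert_nonempty _ _, ?_, d, hd.1, ?_, ?_⟩
      · have hto : ∀ a ∈ ((insert y C : Finset V) : Set V),
            (within G ((insert y C : Finset V) : Set V)).Reachable a c := by
          intro a ha
          have ha' : a = y ∨ a ∈ C := by simpa using ha
          rcases ha' with rfl | ha'
          · exact Adj.reachable ⟨hcy.symm, by simp, by simp [hc]⟩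
          · exact (hCconn a ha' c hc).mono (within_mono (fun _ _ _ _ h => h)
              (by exact_mod_cast Finset.subset_insert y C))
        exact fun a ha b hb => (hto a ha).trans (hto b hb).symm
      · rw [Finset.mem_insert, not_or]
        exact ⟨fun h => hd.2.2 c hc (h ▸ hcy), hd.2.1⟩
      · intro c' hc'
        rcases Finset.mem_insert.1 hc' with rfl | h
        · exact hn
        · exact hd.2.2 c' h
    have := hmax _ hm
    rw [Finset.card_insert_of_notMem hyC] at this
    omega
  have hd₀D : d₀ ∈ D := by simp [hD, hd₀A, hd₀C]; exact hd₀
  have hDA : D ⊆ A := Finset.filter_subset _ _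
  have hDss : D ⊂ A := by
    obtain ⟨c, hc⟩ := hCne
    refine Finset.ssubset_iff_subset_ne.2 ⟨hDA, fun h => ?_⟩
    have : c ∈ D := h ▸ hCA hc
    simp only [hD, Finset.mem_filter] at this
    exact this.2.1 hc
  obtain ⟨x, hxD, hx⟩ := ih D hDss ⟨d₀, hd₀D⟩ (hA.mono (by exact_mod_cast hDA))
  have hxD' := hxD
  simp only [hD, Finset.mem_filter] at hxD'
  refine ⟨x, hxD'.1, ?_⟩
  have hcase : ∀ y, y ∈ A → G.Adj x y → y ∉ C ∧ (y ∈ D ∨ ∃ c ∈ C, G.Adj c y) := by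
    intro y hy hxy
    have hyC : y ∉ C := fun h => hxD'.2.2 y h hxy.symm
    refine ⟨hyC, ?_⟩
    by_cases h : ∃ c ∈ C, G.Adj c y
    · exact Or.inr h
    · push Not at h
      exact Or.inl (by simp only [hD, Finset.mem_filter]; exact ⟨hy, hyC, h⟩)
  rintro y ⟨hyA, hxy⟩ z ⟨hzA, hxz⟩ hyz
  obtain ⟨hyC, hy⟩ := hcase y hyA hxy
  obtain ⟨hzC, hz⟩ := hcase z hzA hxz
  rcases hy with hy | hy <;> rcases hz with hz | hz
  · exact hx ⟨hy, hxy⟩ ⟨hz, hxz⟩ hyz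
  · exact (hND z hzA hz y hy hzC).symm
  · exact hND y hyA hy z hz hyC
  · exact hA.adj_of_connOn (C := (C : Set V)) (by exact_mod_cast hCA) hCconn hyA hzA hd₀A hy hz
      hd₀C hd₀ (hND y hyA hy d₀ hd₀D hyC) (hND z hzA hz d₀ hd₀D hzC) hyz

/-! ### Join forests of chordal graphs -/

theorem isAcyclic_sup_edge_of_isolated {T : SimpleGraph W} (hT : T.IsAcyclic) {i j : W}
    (hi : ∀ k, ¬ T.Adj i k) (hij : i ≠ j) : (T ⊔ edge i j).IsAcyclic := by
  refine hT.sup_edge_of_not_reachable fun ⟨p⟩ => ?_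
  cases p with
  | nil => exact hij rfl
  | cons h _ => exact hi _ h

/-- A finite family of bags which covers the cliques of a chordal graph by cliques has a join
forest: the bags through each vertex are connected in it. -/
theorem exists_joinForest {G : SimpleGraph V} (B : W → Set V) (A : Finset V) (I : Finset W)
    (hA : ChordalOn G A) (hB : ∀ i ∈ I, G.IsClique (B i ∩ A))
    (hcov : ∀ Q ⊆ (A : Set V), G.IsClique Q → ∃ i ∈ I, Q ⊆ B i) :
    ∃ T : SimpleGraph W, T.IsAcyclic ∧ (∀ a b, T.Adj a b → a ∈ I ∧ b ∈ I) ∧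
      ∀ x ∈ A, ConnOn T {i | i ∈ I ∧ x ∈ B i} := by
  classical
  induction hn : A.card + I.card using Nat.strong_induction_on generalizing A I with
  | _ n ih =>
  subst hn
  rcases A.eq_empty_or_nonempty with rfl | hne
  · exact ⟨⊥, isAcyclic_bot, fun a b h => h.elim, by simp⟩
  obtain ⟨x, hxA, hx⟩ := exists_simplicial A hne hA
  obtain ⟨j, hjI, hj⟩ := hcov (insert x {y | y ∈ A ∧ G.Adj x y})
    (Set.insert_subset hxA fun y hy => hy.1) (hx.insert fun y hy _ => hy.2)
  -- The bag `j` contains the closed neighbourhood of the simplicial vertex `x` in `A`. Any other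
  -- bag through `x` is contained in `j` on `A`, so it can be hung on `j` as a leaf; if there is
  -- none, `x` imposes no condition and can be deleted.
  by_cases hi : ∃ i ∈ I, i ≠ j ∧ x ∈ B i
  · obtain ⟨i, hiI, hij, hxi⟩ := hi
    have hsub : B i ∩ A ⊆ B j := by
      rintro y ⟨hyi, hyA⟩
      apply hj
      by_cases hyx : y = x
      · exact Or.inl hyx
      · exact Or.inr ⟨hyA, hB i hiI ⟨hxi, hxA⟩ ⟨hyi, hyA⟩ (Ne.symm hyx)⟩
    obtain ⟨T, hT, hTI, hTc⟩ := ih (A.card + (I.erase i).card)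
      (by have := Finset.card_erase_lt_of_mem hiI; omega) A (I.erase i) hA
      (fun k hk => hB k (Finset.mem_of_mem_erase hk)) (by
        intro Q hQ hQc
        obtain ⟨k, hk, hQk⟩ := hcov Q hQ hQc
        by_cases hki : k = i
        · subst hki
          exact ⟨j, Finset.mem_erase.2 ⟨hij.symm, hjI⟩, fun y hy => hsub ⟨hQk hy, hQ hy⟩⟩
        · exact ⟨k, Finset.mem_erase.2 ⟨hki, hk⟩, hQk⟩) rfl
    refine ⟨T ⊔ edge i j, isAcyclic_sup_edge_of_isolated hT
      (fun k hk => Finset.notMem_erase i I (hTI i k hk).1) hij, ?_, ?_⟩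
    · rintro a b (h | h)
      · exact (hTI a b h).imp Finset.mem_of_mem_erase Finset.mem_of_mem_erase
      · rw [edge_adj] at h
        rcases h.1 with ⟨rfl, rfl⟩ | ⟨rfl, rfl⟩
        · exact ⟨hiI, hjI⟩
        · exact ⟨hjI, hiI⟩
    · intro y hy
      set P := {k | k ∈ I ∧ y ∈ B k} with hP
      set P' := {k | k ∈ I.erase i ∧ y ∈ B k} with hP'
      have hPP : P' ⊆ P := fun k hk => ⟨Finset.mem_of_mem_erase hk.1, hk.2⟩
      have hle : within T P' ≤ within (T ⊔ edge i j) P :=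
        within_mono (fun _ _ _ _ h => Or.inl h) hPP
      have hmem : ∀ k ∈ P, k = i ∨ k ∈ P' := by
        intro k hk
        by_cases h : k = i
        · exact Or.inl h
        · exact Or.inr ⟨Finset.mem_erase.2 ⟨h, hk.1⟩, hk.2⟩
      by_cases hyi : y ∈ B i
      · have hjP : j ∈ P' := ⟨Finset.mem_erase.2 ⟨hij.symm, hjI⟩, hsub ⟨hyi, hy⟩⟩
        have hto : ∀ k ∈ P, (within (T ⊔ edge i j) P).Reachable k j := by
          intro k hk
          rcases hmem k hk with rfl | hk'
          · exact Adj.reachable ⟨Or.inr (by simp [edge_adj, hij]), hk, hPP hjP⟩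
          · exact (hTc y hy k hk' j hjP).mono hle
        exact fun a ha b hb => (hto a ha).trans (hto b hb).symm
      · have hmem' : ∀ k ∈ P, k ∈ P' := fun k hk =>
          (hmem k hk).resolve_left fun h => hyi (h ▸ hk.2)
        exact fun a ha b hb => (hTc y hy a (hmem' a ha) b (hmem' b hb)).mono hle
  · push Not at hi
    have hsub : ((A.erase x : Finset V) : Set V) ⊆ A := by
      exact_mod_cast Finset.erase_subset x A
    obtain ⟨T, hT, hTI, hTc⟩ := ih ((A.erase x).card + I.card)
      (by have := Finset.card_erase_lt_of_mem hxA; omega) (A.erase x) I (hA.mono hsub)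
      (fun k hk => (hB k hk).subset (Set.inter_subset_inter_right _ hsub))
      (fun Q hQ => hcov Q (hQ.trans hsub)) rfl
    refine ⟨T, hT, hTI, fun y hy => ?_⟩
    by_cases hyx : y = x
    · subst hyx
      have : ∀ k ∈ {k | k ∈ I ∧ y ∈ B k}, k = j := fun k hk =>
        by_contra fun h => hi k hk.1 h hk.2
      intro a ha b hb
      rw [this a ha, this b hb]
    · exact hTc y (Finset.mem_erase.2 ⟨hyx, hy⟩)

/-! ### Local trees and their compatible choice -/

/-- `T` is a tree on `K v` which induces a connected graph on each of the sets `K v ∩ K x`. -/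
structure IsLocalTree (K : V → Set W) (v : V) (T : SimpleGraph W) : Prop where
  acyclic : T.IsAcyclic
  mem : ∀ a b, T.Adj a b → a ∈ K v ∧ b ∈ K v
  conn : ∀ x, ConnOn T (K v ∩ K x)

/-- The parts of both trees on the overlap connect it, so exchanging them keeps acyclicity. A lost
edge of `T` inside `K x` is replaced by a path of `R` in `K u ∩ K v ∩ K x`, which is connected in
`R` as an intersection of connected sets in a forest. -/
theorem IsLocalTree.substitute [Finite W] {K : V → Set W} {u v : V} {R T : SimpleGraph W}
    (hR : IsLocalTree K u R) (hT : IsLocalTree K v T) :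
    IsLocalTree K v (within R (K u ∩ K v) ⊔ (T \ within T (K u ∩ K v))) where
  acyclic := isAcyclic_sup_sdiff (SA := K u ∩ K v) (SB := Set.univ)
    (hR.acyclic.anti (within_le _ _)) hT.acyclic (fun _ _ h => h.2)
    (fun _ _ _ => ⟨trivial, trivial⟩)
    (within_le _ _) fun s hs t ht => by
      have := hT.conn u
      rw [Set.inter_comm] at this
      exact this s hs.1 t ht.1
  mem a b h := h.elim (fun h => ⟨h.2.1.2, h.2.2.2⟩) (fun h => hT.mem a b h.1)
  conn x := by
    intro a ha b hb
    refine reachable_of_forall_adj (fun c d hcd => ?_) (hT.conn x a ha b hb)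
    by_cases h : c ∈ K u ∧ d ∈ K u
    · have h1 := (hR.conn v).inter hR.acyclic (hR.conn x)
      refine (h1 c ⟨⟨h.1, hcd.2.1.1⟩, h.1, hcd.2.1.2⟩ d ⟨⟨h.2, hcd.2.2.1⟩, h.2, hcd.2.2.2⟩).mono ?_
      exact within_mono (fun y z hy hz hyz => Or.inl ⟨hyz, hy.1, hz.1⟩)
        fun y hy => ⟨hy.1.2, hy.2.2⟩
    · exact Adj.reachable ⟨Or.inr ⟨hcd.1, fun h' => h ⟨h'.2.1.1, h'.2.2.1⟩⟩, hcd.2⟩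

open Classical in
/-- A code of a finite graph as a natural number, for a numbering `f` of the possible edges. -/
noncomputable def graphCode [Fintype W] (f : Sym2 W → ℕ) (T : SimpleGraph W) : ℕ :=
  ∑ e : Sym2 W, if e ∈ T.edgeSet then 2 ^ f e else 0

theorem graphCode_injective [Fintype W] {f : Sym2 W → ℕ} (hf : Function.Injective f) :
    Function.Injective (graphCode f) := by
  classical
  have key : ∀ T : SimpleGraph W, graphCode f T =
      ∑ i ∈ (Finset.univ.filter (· ∈ T.edgeSet)).image f, 2 ^ i := by
    intro T
    rw [Finset.sum_image hf.injOn, Finset.sum_filter, graphCode]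
  intro S T h
  rw [key, key] at h
  have h := Finset.image_injective hf (Finset.geomSum_injective le_rfl h)
  rw [← edgeSet_inj]
  ext e
  simpa using Finset.ext_iff.1 h e

/-- The code is additive over edges, so a substitution changes it only by the difference of the two
parts on `S`. Minimality of `T` thereby passes to its part on `S`. -/
theorem graphCode_substitute [Fintype W] (f : Sym2 W → ℕ) (R T : SimpleGraph W) (S : Set W) :
    graphCode f (within R S ⊔ (T \ within T S)) + graphCode f (within T S) =
      graphCode f (within R S) + graphCode f T := by
  classical
  unfold graphCode
  rw [← Finset.sum_add_distrib, ← Finset.sum_add_distrib]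
  refine Finset.sum_congr rfl fun e _ => ?_
  induction e with
  | h a b =>
  simp only [mem_edgeSet, sup_adj, sdiff_adj, within]
  by_cases h1 : R.Adj a b <;> by_cases h2 : T.Adj a b <;> by_cases h3 : a ∈ S ∧ b ∈ S <;>
    simp [h1, h2, h3]

/-- Choose each tree of minimal code. Substituting in both directions shows that the two parts on an
overlap have equal codes, hence are equal. -/
theorem exists_compatible_localTree [Finite W] {K : V → Set W}
    (h : ∀ v, ∃ T, IsLocalTree K v T) : ∃ T : V → SimpleGraph W, (∀ v, IsLocalTree K v (T v)) ∧
      ∀ u v, within (T u) (K u ∩ K v) = within (T v) (K u ∩ K v) := by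
  classical
  have := Fintype.ofFinite W
  obtain ⟨f, hf⟩ := Countable.exists_injective_nat (Sym2 W)
  have hmin : ∀ v, ∃ T, IsLocalTree K v T ∧ ∀ T', IsLocalTree K v T' →
      graphCode f T ≤ graphCode f T' := fun v => by
    obtain ⟨T, hT, hT'⟩ := Set.exists_min_image {T | IsLocalTree K v T} (graphCode f)
      (Set.toFinite _) (h v)
    exact ⟨T, hT, hT'⟩
  choose T hT hTmin using hmin
  refine ⟨T, hT, fun u v => graphCode_injective hf (le_antisymm ?_ ?_)⟩
  · have h1 := hTmin u _ ((hT v).substitute (hT u))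
    have h2 := graphCode_substitute f (T v) (T u) (K v ∩ K u)
    rw [Set.inter_comm (K u)]
    omega
  · have h1 := hTmin v _ ((hT u).substitute (hT v))
    have h2 := graphCode_substitute f (T u) (T v) (K u ∩ K v)
    omega

theorem exists_graph_within_isLocalTree [Finite W] {K : V → Set W}
    (h : ∀ v, ∃ T, IsLocalTree K v T) : ∃ H : SimpleGraph W,
      (∀ v, IsLocalTree K v (within H (K v))) ∧
      ∀ a b, H.Adj a b → ∃ v, a ∈ K v ∧ b ∈ K v := by
  obtain ⟨T, hT, hTT⟩ := exists_compatible_localTree h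
  refine ⟨⨆ v, T v, fun v => ?_, fun a b hab => ?_⟩
  · convert hT v
    ext a b
    refine ⟨fun ⟨h1, ha, hb⟩ => ?_, fun h => ⟨?_, (hT v).mem a b h⟩⟩
    · rw [iSup_adj] at h1
      obtain ⟨u, hu⟩ := h1
      have hm := (hT u).mem a b hu
      have : (within (T u) (K u ∩ K v)).Adj a b := ⟨hu, ⟨hm.1, ha⟩, hm.2, hb⟩
      rw [hTT] at this
      exact this.1
    · rw [iSup_adj]
      exact ⟨v, h⟩
  · rw [iSup_adj] at hab
    obtain ⟨v, hv⟩ := hab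
    exact ⟨v, (hT v).mem a b hv⟩

/-! ### Acyclicity of unions of regions -/

/-- The union of the graphs which `H` induces on the sets `K v` with `v ∈ X`. -/
def regionUnion (H : SimpleGraph W) (K : V → Set W) (X : Finset V) : SimpleGraph W :=
  ⨆ v ∈ X, within H (K v)

theorem regionUnion_adj {H : SimpleGraph W} {K : V → Set W} {X : Finset V} {a b : W} :
    (regionUnion H K X).Adj a b ↔ ∃ v ∈ X, H.Adj a b ∧ a ∈ K v ∧ b ∈ K v := by
  simp only [regionUnion, iSup_adj, within, exists_prop]

theorem regionUnion_isAcyclic_of_card_le_two [Finite W] {H : SimpleGraph W} {K : V → Set W}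
    (h : ∀ v, IsLocalTree K v (within H (K v))) {X : Finset V} (hX : X.card ≤ 2) :
    (regionUnion H K X).IsAcyclic := by
  classical
  rcases X.eq_empty_or_nonempty with rfl | ⟨u, hu⟩
  · simp [regionUnion]
  have : ∃ v, X ⊆ {u, v} := by
    have hc : (X.erase u).card ≤ 1 := by rw [Finset.card_erase_of_mem hu]; omega
    rcases (X.erase u).eq_empty_or_nonempty with he | ⟨v, hv⟩
    · refine ⟨u, fun x hx => ?_⟩
      by_contra hn
      have : x ∈ X.erase u := by simp at hn; simp [hx, hn]
      simp [he] at this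
    · refine ⟨v, fun x hx => ?_⟩
      by_cases hxu : x = u
      · simp [hxu]
      · simp [Finset.card_le_one.1 hc x (by simp [hx, hxu]) v hv]
  obtain ⟨v, hv⟩ := this
  have hle : regionUnion H K X ≤ within H (K u) ⊔ within H (K v) := by
    intro a b hab
    obtain ⟨x, hx, hab⟩ := regionUnion_adj.1 hab
    have := hv hx
    simp only [Finset.mem_insert, Finset.mem_singleton] at this
    rcases this with rfl | rfl
    · exact Or.inl hab
    · exact Or.inr hab
  refine IsAcyclic.anti hle (isAcyclic_sup (SA := K u) (SB := K v) (h u).acyclic (h v).acyclic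
    (fun _ _ h => h.2) (fun _ _ h => h.2) fun s hs t ht => ?_)
  have hle : within (within H (K u)) (K u ∩ K v) ≤ within H (K u) ⊓ within H (K v) :=
    fun a b hab => ⟨hab.1, hab.1.1, hab.2.1.2, hab.2.2.2⟩
  exact ((h u).conn v s hs t ht).mono hle

/-- If the sets `K v` satisfy the Helly property for the cliques of `G`, acyclicity passes from
pairs of regions to unions over all sets of vertices that induce chordal subgraphs. -/
theorem regionUnion_isAcyclic_of_chordalOn [Finite W] {G : SimpleGraph V} {H : SimpleGraph W}
    {K : V → Set W} (hadj : ∀ u v, u ≠ v → (K u ∩ K v).Nonempty → G.Adj u v)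
    (hcl : ∀ x u v, G.Adj x u → G.Adj x v → (u ≠ v → G.Adj u v) →
      ∃ M, M ∈ K x ∧ M ∈ K u ∧ M ∈ K v)
    (hconn : ∀ v, ConnOn H (K v)) (h2 : ∀ X : Finset V, X.card ≤ 2 → (regionUnion H K X).IsAcyclic)
    (X : Finset V) (hX : ChordalOn G X) : (regionUnion H K X).IsAcyclic := by
  classical
  -- Both regions are connected in the forest `regionUnion H K {u, v}`, hence so is their
  -- intersection.
  have hint : ∀ u v, ConnOn H (K u ∩ K v) := by
    intro u v
    have hR : ∀ w ∈ ({u, v} : Finset V), ConnOn (regionUnion H K {u, v}) (K w) := fun w hw =>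
      (hconn w).mono fun a b ha hb hab => regionUnion_adj.2 ⟨w, hw, hab, ha, hb⟩
    refine ((hR u (by simp)).inter (h2 _ Finset.card_le_two) (hR v (by simp))).mono
      fun a b _ _ hab => ?_
    obtain ⟨_, _, h, _⟩ := regionUnion_adj.1 hab
    exact h
  induction X using Finset.strongInduction with
  | H X ih =>
  rcases X.eq_empty_or_nonempty with rfl | hne
  · simp [regionUnion]
  obtain ⟨x, hxX, hx⟩ := exists_simplicial X hne hX
  have ih := ih (X.erase x) (Finset.erase_ssubset hxX)
    (hX.mono (by exact_mod_cast Finset.erase_subset x X))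
  have hle : regionUnion H K X ≤ regionUnion H K (X.erase x) ⊔ within H (K x) := by
    intro a b hab
    obtain ⟨v, hv, hab⟩ := regionUnion_adj.1 hab
    by_cases hvx : v = x
    · exact Or.inr (hvx ▸ hab)
    · exact Or.inl (regionUnion_adj.2 ⟨v, Finset.mem_erase.2 ⟨hvx, hv⟩, hab⟩)
  have hxac : (within H (K x)).IsAcyclic := (h2 {x} (by simp)).anti fun a b hab =>
    regionUnion_adj.2 ⟨x, by simp, hab⟩
  refine IsAcyclic.anti hle (isAcyclic_sup (SA := {M | ∃ u ∈ X.erase x, M ∈ K u}) (SB := K x) ih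
    hxac (fun a b hab => ?_) (fun _ _ h => h.2) ?_)
  · obtain ⟨v, hv, _, ha, hb⟩ := regionUnion_adj.1 hab
    exact ⟨⟨v, hv, ha⟩, v, hv, hb⟩
  · rintro s ⟨⟨u, hu, hsu⟩, hsx⟩ t ⟨⟨v, hv, htv⟩, htx⟩
    have hnb : ∀ w ∈ X.erase x, (∃ M, M ∈ K w ∧ M ∈ K x) → w ∈ X ∧ G.Adj x w :=
      fun w hw ⟨M, hM⟩ => ⟨Finset.mem_of_mem_erase hw,
        hadj x w (Finset.ne_of_mem_erase hw).symm ⟨M, hM.2, hM.1⟩⟩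
    have hu' := hnb u hu ⟨s, hsu, hsx⟩
    have hv' := hnb v hv ⟨t, htv, htx⟩
    -- As `x` is simplicial, `x`, `u`, `v` are pairwise adjacent or equal. A common point `M` of
    -- their regions lets one go from `s` to `M` inside `K u ∩ K x` and on to `t` inside `K v ∩ K
    -- x`.
    obtain ⟨M, hMx, hMu, hMv⟩ := hcl x u v hu'.2 hv'.2 (fun h => hx hu' hv' h)
    have hle : ∀ w ∈ X.erase x,
        within H (K w ∩ K x) ≤ regionUnion H K (X.erase x) ⊓ within H (K x) :=
      fun w hw a b hab => ⟨regionUnion_adj.2 ⟨w, hw, hab.1, hab.2.1.1, hab.2.2.1⟩,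
        hab.1, hab.2.1.2, hab.2.2.2⟩
    exact ((hint u x s ⟨hsu, hsx⟩ M ⟨hMu, hMx⟩).mono (hle u hu)).trans
      ((hint v x M ⟨hMv, hMx⟩ t ⟨htv, htx⟩).mono (hle v hv))

/-! ### Passing between subgraphs and graphs; edge counts of forests -/

theorem exists_walk_coe {G : SimpleGraph V} (S : G.Subgraph) {u v : V} (p : G.Walk u v)
    (hp : ∀ e ∈ p.edges, e ∈ S.edgeSet) (hu : u ∈ S.verts) :
    ∃ (hv : v ∈ S.verts) (q : S.coe.Walk ⟨u, hu⟩ ⟨v, hv⟩), q.map S.hom = p := by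
  induction p with
  | nil => exact ⟨hu, Walk.nil, rfl⟩
  | @cons u w v h p ih =>
    have hadj : S.Adj u w := hp s(u, w) (by simp)
    obtain ⟨hv, q, hq⟩ := ih (fun e he => hp e (by simp [he])) hadj.snd_mem
    exact ⟨hv, Walk.cons (show S.coe.Adj ⟨u, hu⟩ ⟨w, hadj.snd_mem⟩ from hadj) q, by
      rw [← hq]; rfl⟩

theorem coe_isAcyclic_iff {G : SimpleGraph V} (S : G.Subgraph) :
    S.coe.IsAcyclic ↔ S.spanningCoe.IsAcyclic := by
  refine ⟨fun h v c hc => ?_, fun h => h.comap ⟨Subtype.val, fun h => h⟩ Subtype.val_injective⟩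
  have hv : v ∈ S.verts := by
    cases c with
    | nil => exact absurd rfl hc.ne_nil
    | cons h _ => exact S.edge_vert h
  have hle : S.spanningCoe ≤ G := S.spanningCoe_le
  obtain ⟨_, q, hq⟩ := exists_walk_coe S (c.mapLe hle) (fun e he => by
    rw [Walk.edges_mapLe_eq_edges] at he
    have := c.edges_subset_edgeSet he
    rwa [Subgraph.edgeSet_spanningCoe] at this) hv
  refine h q ?_
  rw [← Walk.isCycle_map_iff_of_injective S.hom_injective, hq]
  exact hc.mapLe hle

theorem connected_iff_spanningCoe {G : SimpleGraph V} (S : G.Subgraph) :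
    S.Connected ↔ S.verts.Nonempty ∧
      ∀ a ∈ S.verts, ∀ b ∈ S.verts, S.spanningCoe.Reachable a b := by
  refine ⟨fun h => ⟨h.nonempty, fun a ha b hb => ?_⟩, fun ⟨hne, h⟩ => ?_⟩
  · exact (h.coe.preconnected ⟨a, ha⟩ ⟨b, hb⟩).map
      (⟨Subtype.val, fun h => h⟩ : S.coe →g S.spanningCoe)
  · have := hne.to_subtype
    refine ⟨⟨fun ⟨a, ha⟩ ⟨b, hb⟩ => ?_⟩⟩
    obtain ⟨p⟩ := h a ha b hb
    obtain ⟨_, q, -⟩ := exists_walk_coe S (p.mapLe S.spanningCoe_le) (fun e he => by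
      rw [Walk.edges_mapLe_eq_edges] at he
      have := p.edges_subset_edgeSet he
      rwa [Subgraph.edgeSet_spanningCoe] at this) ha
    exact q.reachable

/-- Extend the forest to a spanning tree of the complete graph on its vertices and compare edge
numbers. -/
theorem ncard_edgeSet_of_isAcyclic {G : SimpleGraph W} [Finite W] (S : G.Subgraph)
    (hne : S.verts.Nonempty) (hS : S.coe.IsAcyclic) :
    S.edgeSet.ncard + 1 ≤ S.verts.ncard ∧
      (S.edgeSet.ncard + 1 = S.verts.ncard ↔ S.Connected) := by
  have := hne.to_subtype
  have hcard : S.edgeSet.ncard = S.coe.edgeSet.ncard := by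
    rw [← S.image_coe_edgeSet_coe,
      Set.ncard_image_of_injective _ (Sym2.map.injective Subtype.val_injective)]
  obtain ⟨T, hle, -, hT⟩ := (connected_top (V := S.verts)).exists_isTree_le_of_le_of_isAcyclic
    le_top hS
  have hTc : T.edgeSet.ncard + 1 = S.verts.ncard := (isTree_iff_connected_and_card.1 hT).2
  have hsub : S.coe.edgeSet ⊆ T.edgeSet := edgeSet_subset_edgeSet.2 hle
  have hle' := Set.ncard_le_ncard hsub (Set.toFinite _)
  refine ⟨by omega, fun h => ⟨?_⟩, fun h => ?_⟩
  · have : S.coe = T := edgeSet_inj.1 (Set.eq_of_subset_of_ncard_le hsub (by omega))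
    rw [this]
    exact hT.connected
  · rw [hcard]
    exact (isTree_iff_connected_and_card.1 ⟨h.coe, hS⟩).2

/-! ### Chordal subgraphs from chordal balls -/

/-- An edge of a walk splits it into two walks from the ends of the walk to those of the edge. -/
theorem exists_walks_of_mem_edges {G : SimpleGraph V} {u v a b : V} (p : G.Walk u v)
    (h : s(a, b) ∈ p.edges) :
    (∃ (q : G.Walk u a) (q' : G.Walk v b), q.length + q'.length + 1 = p.length) ∨
      ∃ (q : G.Walk u b) (q' : G.Walk v a), q.length + q'.length + 1 = p.length := by
  induction p with
  | nil => simp at h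
  | cons hadj p ih =>
    rw [Walk.edges_cons, List.mem_cons] at h
    rcases h with h | h
    · rcases Sym2.eq_iff.1 h with ⟨rfl, rfl⟩ | ⟨rfl, rfl⟩
      · exact Or.inl ⟨Walk.nil, p.reverse, by simp⟩
      · exact Or.inr ⟨Walk.nil, p.reverse, by simp⟩
    · rcases ih h with ⟨q, q', hq⟩ | ⟨q, q', hq⟩
      · exact Or.inl ⟨Walk.cons hadj q, q', by simp; omega⟩
      · exact Or.inr ⟨Walk.cons hadj q, q', by simp; omega⟩

theorem exists_chord_of_halfBall {G : SimpleGraph V} {r : ℕ} {v w : V}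
    (h : IsChordal (halfBall G v r).coe) (c : G.Walk w w) (hc : c.IsCycle) (hl : 4 ≤ c.length)
    (hw : w ∈ (halfBall G v r).verts)
    (he : ∀ a b, s(a, b) ∈ c.edges → G.edist v a + G.edist v b < r) :
    ∃ x ∈ c.support, ∃ y ∈ c.support, G.Adj x y ∧ s(x, y) ∉ c.edges := by
  obtain ⟨_, q, hq⟩ := exists_walk_coe (halfBall G v r) c (fun e hec => by
    induction e with
    | h a b => exact ⟨c.adj_of_mem_edges hec, he a b hec⟩) hw
  have hqc : q.IsCycle := by
    rw [← Walk.isCycle_map_iff_of_injective (halfBall G v r).hom_injective, hq]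
    exact hc
  have hql : q.length = c.length := by
    rw [← hq]
    exact (Walk.length_map _ _).symm
  have hqs : q.support.map Subtype.val = c.support := by
    rw [← hq]
    exact (Walk.support_map (halfBall G v r).hom q).symm
  have hqe : q.edges.map (Sym2.map Subtype.val) = c.edges := by
    rw [← hq]
    exact (Walk.edges_map (halfBall G v r).hom q).symm
  obtain ⟨x, hx, y, hy, hxy, hn⟩ := h _ q hqc (by omega)
  have hs : ∀ z ∈ q.support, z.1 ∈ c.support := fun z hz => by
    rw [← hqs]
    exact List.mem_map_of_mem hz
  refine ⟨x, hs x hx, y, hs y hy, hxy.1, fun hmem => hn ?_⟩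
  rw [← hqe, List.mem_map] at hmem
  obtain ⟨e, heq, hmap⟩ := hmem
  have : e = s(x, y) := Sym2.map.injective Subtype.val_injective hmap
  exact this ▸ heq

/-- This is where `3 ≤ r` is needed: an edge between two neighbours of `v` has distance sum at most
2, and belongs to the ball only if that is less than `r`. -/
theorem IsLocallyChordal.chordalOn_neighborhood {G : SimpleGraph V} {r : ℕ} (hr : 3 ≤ r)
    (hG : IsLocallyChordal G r) (v : V) : ChordalOn G {u | G.Adj v u ∨ v = u} := by
  intro w c hc hl hs
  have h1 : ∀ x ∈ c.support, G.edist v x ≤ 1 := fun x hx => edist_le_one_iff_adj_or_eq.2 (hs x hx)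
  refine exists_chord_of_halfBall (hG v) c hc hl ?_ fun a b hab => ?_
  · calc 2 * G.edist v w ≤ 2 * 1 := mul_le_mul_right (h1 w c.start_mem_support) 2
      _ ≤ (r : ℕ∞) := by rw [mul_one]; exact_mod_cast (by omega : 2 ≤ r)
  · calc G.edist v a + G.edist v b ≤ 1 + 1 :=
          add_le_add (h1 a (c.fst_mem_support_of_mem_edges hab))
            (h1 b (c.snd_mem_support_of_mem_edges hab))
      _ < (r : ℕ∞) := by rw [one_add_one_eq_two]; exact_mod_cast (by omega : 2 < r)

/-- A cycle in `X` has length at most `r`. Removing an edge leaves two walks from the base point to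
its ends of total length less than `r`, so the whole cycle lies in the ball around that point. -/
theorem IsLocallyChordal.chordalOn_of_card_le {G : SimpleGraph V} {r : ℕ}
    (hG : IsLocallyChordal G r) (X : Finset V) (hX : X.card ≤ r) : ChordalOn G X := by
  classical
  intro w c hc hl hs
  have hlen : c.length ≤ r := by
    have h1 : c.support.tail.length = c.length := by simp
    rw [← h1, ← List.toFinset_card_of_nodup hc.support_nodup]
    refine (Finset.card_le_card fun x hx => ?_).trans hX
    exact hs x (List.mem_of_mem_tail (List.mem_toFinset.1 hx))
  refine exists_chord_of_halfBall (hG w) c hc hl (by simp [halfBall]) fun a b hab => ?_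
  have key : ∀ {a b : V} (q : G.Walk w a) (q' : G.Walk w b), q.length + q'.length + 1 = c.length →
      G.edist w a + G.edist w b < r := fun q q' h =>
    lt_of_le_of_lt (add_le_add (edist_le q) (edist_le q'))
      (by exact_mod_cast (by omega : q.length + q'.length < r))
  rcases exists_walks_of_mem_edges c hab with ⟨q, q', h⟩ | ⟨q, q', h⟩
  · exact key q q' h
  · rw [add_comm]
    exact key q q' h

/-! ### Clique graphs and the weight count -/

theorem coPart_adj {G : SimpleGraph V} {H : (cliqueIntersectionGraph G).Subgraph} {v : V}
    {M N : MaxClique G} :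
    (coPart G H v).Adj M N ↔ M ∈ cliquesThrough G v ∧ N ∈ cliquesThrough G v ∧ H.Adj M N :=
  Iff.rfl

theorem isAcyclicFamily_coPart_iff {G : SimpleGraph V}
    {H : (cliqueIntersectionGraph G).Subgraph} {r : ℕ} :
    IsAcyclicFamily (coPart G H) r ↔ ∀ X : Finset V, X.card ≤ r →
      (regionUnion H.spanningCoe (cliquesThrough G) X).IsAcyclic := by
  refine forall₂_congr fun X _ => ?_
  rw [coe_isAcyclic_iff]
  have : (⨆ v ∈ X, coPart G H v).spanningCoe =
      regionUnion H.spanningCoe (cliquesThrough G) X := by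
    ext M N
    simp only [Subgraph.spanningCoe_adj, Subgraph.iSup_adj, regionUnion_adj, coPart_adj]
    exact ⟨fun ⟨v, hv, h1, h2, h3⟩ => ⟨v, hv, h3, h1, h2⟩,
      fun ⟨v, hv, h3, h1, h2⟩ => ⟨v, hv, h1, h2, h3⟩⟩
  rw [this]

theorem IsAcyclicFamily.coPart_isAcyclic {G : SimpleGraph V}
    {H : (cliqueIntersectionGraph G).Subgraph} {r : ℕ} (hr : 1 ≤ r) (h : IsAcyclicFamily (coPart G H) r) (v : V) : (coPart G H v).coe.IsAcyclic := by
  rw [isAcyclicFamily_coPart_iff] at h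
  rw [coe_isAcyclic_iff]
  refine (h {v} (by simpa using hr)).anti fun M N hMN => ?_
  exact regionUnion_adj.2 ⟨v, by simp, hMN.2.2, hMN.1, hMN.2.1⟩

section CliqueGraph

variable [Finite V] {G : SimpleGraph V}

theorem exists_maxClique_of_isClique {Q : Set V} (hQ : G.IsClique Q) :
    ∃ M : MaxClique G, Q ⊆ M.1 := by
  obtain ⟨M, hQM, hM⟩ := (Set.toFinite {Q : Set V | G.IsClique Q}).exists_le_maximal hQ
  exact ⟨⟨M, hM⟩, hQM⟩

theorem cliquesThrough_nonempty (v : V) : (cliquesThrough G v).Nonempty := by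
  obtain ⟨M, hM⟩ := exists_maxClique_of_isClique (G := G) (isClique_singleton v)
  exact ⟨M, hM rfl⟩

theorem adj_iff_cliquesThrough_inter_nonempty {u v : V} (huv : u ≠ v) :
    G.Adj u v ↔ (cliquesThrough G u ∩ cliquesThrough G v).Nonempty := by
  refine ⟨fun h => ?_, fun ⟨M, hu, hv⟩ => M.2.prop hu hv huv⟩
  obtain ⟨M, hM⟩ := exists_maxClique_of_isClique (G := G) (Q := {u, v})
    (isClique_pair.2 fun _ => h)
  exact ⟨M, hM (by simp), hM (by simp)⟩

theorem coPart_connected_iff {H : (cliqueIntersectionGraph G).Subgraph} {v : V} :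
    (coPart G H v).Connected ↔ ConnOn H.spanningCoe (cliquesThrough G v) := by
  rw [connected_iff_spanningCoe]
  have : (coPart G H v).spanningCoe = within H.spanningCoe (cliquesThrough G v) := by
    ext M N
    exact ⟨fun ⟨h1, h2, h3⟩ => ⟨h3, h1, h2⟩, fun ⟨h3, h1, h2⟩ => ⟨h1, h2, h3⟩⟩
  rw [this]
  exact ⟨fun h => h.2, fun h => ⟨cliquesThrough_nonempty v, h⟩⟩

/-- Every edge of `G` extends to a maximal clique, so the adjacency condition always holds and only
connectedness matters. -/
theorem isCliqueGraph_iff {H : (cliqueIntersectionGraph G).Subgraph} (hH : H.IsSpanning) :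
    IsCliqueGraph G H ↔ ∀ v, (coPart G H v).Connected := by
  refine ⟨fun h => h.2.connected, fun h => ⟨hH, fun v => ⟨fun M _ => hH M, fun M N h => h.2.2⟩, h,
    fun u v huv => adj_iff_cliquesThrough_inter_nonempty huv⟩⟩

/-- Double counting: an edge `MN` lies in the part at `v` exactly for the `|M ∩ N|` vertices `v` of
`M ∩ N`. -/
theorem totalWeight_eq_sum [Fintype V] (H : (cliqueIntersectionGraph G).Subgraph) :
    totalWeight G H = ∑ v, (coPart G H v).edgeSet.ncard := by
  classical
  have := Fintype.ofFinite (MaxClique G)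
  rw [totalWeight, finsum_mem_eq_toFinset_sum]
  have h1 : ∀ e ∈ H.edgeSet.toFinset,
      edgeWeight G e = ∑ v, if e ∈ (coPart G H v).edgeSet then 1 else 0 := by
    intro e he
    rw [Finset.sum_boole, Nat.cast_id, ← Set.ncard_coe_finset]
    rw [Set.mem_toFinset] at he
    induction e with
    | h M N =>
    change (M.1 ∩ N.1).ncard = _
    congr 1
    ext v
    simp only [Finset.coe_filter, Finset.mem_univ, true_and, Set.mem_ofPred_eq,
      Subgraph.mem_edgeSet, coPart_adj]
    exact ⟨fun h => ⟨h.1, h.2, he⟩, fun h => ⟨h.1, h.2.1⟩⟩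
  rw [Finset.sum_congr rfl h1, Finset.sum_comm]
  refine Finset.sum_congr rfl fun v _ => ?_
  rw [Finset.sum_boole, Nat.cast_id, ← Set.ncard_coe_finset]
  congr 1
  ext e
  simp only [Finset.coe_filter, Set.mem_toFinset, Set.mem_ofPred_eq, and_iff_right_iff_imp]
  induction e with
  | h M N => exact fun h => h.2.2

theorem sum_ncard_cliquesThrough [Fintype V] :
    ∑ v, (cliquesThrough G v).ncard = ∑ᶠ K : MaxClique G, K.1.ncard := by
  classical
  have := Fintype.ofFinite (MaxClique G)
  rw [finsum_eq_sum_of_fintype]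
  have h1 : ∀ v : V, (cliquesThrough G v).ncard = ∑ K : MaxClique G, if v ∈ K.1 then 1 else 0 := by
    intro v
    rw [Finset.sum_boole, Nat.cast_id, ← Set.ncard_coe_finset]
    congr 1
    ext K
    simp [cliquesThrough]
  have h2 : ∀ K : MaxClique G, K.1.ncard = ∑ v : V, if v ∈ K.1 then 1 else 0 := by
    intro K
    rw [Finset.sum_boole, Nat.cast_id, ← Set.ncard_coe_finset]
    congr 1
    ext v
    simp
  simp_rw [h1, h2]
  exact Finset.sum_comm

theorem totalWeight_add_card {H : (cliqueIntersectionGraph G).Subgraph}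
    (h : ∀ v, (coPart G H v).coe.IsAcyclic) :
    totalWeight G H + Nat.card V ≤ ∑ᶠ K : MaxClique G, K.1.ncard ∧
      (totalWeight G H + Nat.card V = ∑ᶠ K : MaxClique G, K.1.ncard ↔
        ∀ v, (coPart G H v).Connected) := by
  classical
  have := Fintype.ofFinite V
  have hv : ∀ v, (coPart G H v).edgeSet.ncard + 1 ≤ (cliquesThrough G v).ncard ∧
      ((coPart G H v).edgeSet.ncard + 1 = (cliquesThrough G v).ncard ↔
        (coPart G H v).Connected) := fun v =>
    ncard_edgeSet_of_isAcyclic (coPart G H v) (cliquesThrough_nonempty v) (h v)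
  have hsum : totalWeight G H + Nat.card V = ∑ v, ((coPart G H v).edgeSet.ncard + 1) := by
    rw [totalWeight_eq_sum, Finset.sum_add_distrib]
    simp
  rw [hsum, ← sum_ncard_cliquesThrough]
  refine ⟨Finset.sum_le_sum fun v _ => (hv v).1, ?_⟩
  rw [Finset.sum_eq_sum_iff_of_le fun v _ => (hv v).1]
  exact ⟨fun h v => (hv v).2.1 (h v (Finset.mem_univ v)), fun h v _ => (hv v).2.2 (h v)⟩

/-- The maximal cliques through `v` cover all cliques of the closed neighbourhood, since `v` can be
added to each of these. A join forest for them is the required tree; for `x` outside the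
neighbourhood no clique contains both `v` and `x`. -/
theorem exists_isLocalTree_cliquesThrough {v : V} (h : ChordalOn G {u | G.Adj v u ∨ v = u}) :
    ∃ T, IsLocalTree (cliquesThrough G) v T := by
  classical
  have := Fintype.ofFinite V
  have := Fintype.ofFinite (MaxClique G)
  obtain ⟨T, hT, hTI, hTc⟩ := exists_joinForest (G := G) (fun M : MaxClique G => M.1)
    {u | G.Adj v u ∨ v = u}.toFinset (cliquesThrough G v).toFinset (by simpa using h)
    (fun M _ => M.2.prop.subset Set.inter_subset_left) (fun Q hQ hQc => by
      obtain ⟨M, hM⟩ := exists_maxClique_of_isClique (G := G) (Q := insert v Q)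
        (hQc.insert fun u hu huv => by
          have := hQ hu
          simp only [Set.coe_toFinset, Set.mem_ofPred_eq] at this
          exact this.resolve_right huv)
      exact ⟨M, Set.mem_toFinset.2 (hM (Set.mem_insert v Q)), (Set.subset_insert v Q).trans hM⟩)
  refine ⟨T, hT, fun a b hab => by simpa using hTI a b hab, fun x => ?_⟩
  by_cases hx : G.Adj v x ∨ v = x
  · have := hTc x (by simpa using hx)
    simp only [Set.mem_toFinset] at this
    exact this
  · rintro M ⟨hMv, hMx⟩
    exact absurd (or_iff_not_imp_right.2 fun h => M.2.prop hMv hMx h) hx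

theorem IsLocallyChordal.exists_isAcyclicSpanning {r : ℕ} (hr : 3 ≤ r)
    (hG : IsLocallyChordal G r) : ∃ H : (cliqueIntersectionGraph G).Subgraph,
      IsAcyclicSpanning G 2 H ∧ ∀ v, (coPart G H v).Connected := by
  obtain ⟨T, hT, hTK⟩ := exists_graph_within_isLocalTree (K := cliquesThrough G) fun v =>
    exists_isLocalTree_cliquesThrough (hG.chordalOn_neighborhood hr v)
  let H : (cliqueIntersectionGraph G).Subgraph :=
    { verts := Set.univ
      Adj := T.Adj
      adj_sub := fun {a b} hab => ⟨hab.ne, hTK a b hab⟩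
      edge_vert := fun _ => trivial
      symm := T.symm }
  have hHT : H.spanningCoe = T := rfl
  refine ⟨H, ⟨fun _ => trivial, isAcyclicFamily_coPart_iff.2 fun X hX => ?_⟩, fun v => ?_⟩
  · rw [hHT]
    exact regionUnion_isAcyclic_of_card_le_two hT hX
  · rw [coPart_connected_iff, hHT]
    have := (hT v).conn v
    rw [Set.inter_self] at this
    exact this.mono fun a b _ _ h => h.1

theorem IsLocallyChordal.isAcyclicFamily_coPart {r : ℕ} (hG : IsLocallyChordal G r)
    {H : (cliqueIntersectionGraph G).Subgraph} (h2 : IsAcyclicFamily (coPart G H) 2)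
    (hconn : ∀ v, (coPart G H v).Connected) : IsAcyclicFamily (coPart G H) r := by
  rw [isAcyclicFamily_coPart_iff] at h2 ⊢
  intro X hX
  refine regionUnion_isAcyclic_of_chordalOn (G := G)
    (fun u v huv => (adj_iff_cliquesThrough_inter_nonempty huv).2) (fun x u v hu hv huv => ?_)
    (fun v => coPart_connected_iff.1 (hconn v)) h2 X (hG.chordalOn_of_card_le X hX)
  obtain ⟨M, hM⟩ := exists_maxClique_of_isClique (G := G) (Q := {x, u, v})
    (((isClique_pair.2 huv)).insert fun w hw _ => by
      rcases hw with rfl | rfl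
      · exact hu
      · exact hv)
  exact ⟨M, hM (by simp), hM (by simp), hM (by simp)⟩

end CliqueGraph

end LocChordal

theorem mainTheorem8 {V : Type*} [Finite V] (G : SimpleGraph V) (r : ℕ) (hr : 3 ≤ r)
    (hG : LocChordal.IsLocallyChordal G r)
    (H : (LocChordal.cliqueIntersectionGraph G).Subgraph) :
    List.TFAE
      [LocChordal.IsAcyclicCliqueGraph G r H,
       LocChordal.IsMaxWeightAcyclicSpanning G 2 H,
       LocChordal.IsAcyclicSpanning G 2 H ∧
        (LocChordal.totalWeight G H : ℤ) =
          (∑ᶠ K : LocChordal.MaxClique G, (K.1.ncard : ℤ)) - (Nat.card V : ℤ)] := by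
  have hcast : (∑ᶠ K : LocChordal.MaxClique G, (K.1.ncard : ℤ)) =
      ((∑ᶠ K : LocChordal.MaxClique G, K.1.ncard : ℕ) : ℤ) := by
    have := Fintype.ofFinite (LocChordal.MaxClique G)
    rw [finsum_eq_sum_of_fintype, finsum_eq_sum_of_fintype, Nat.cast_sum]
  have hbound := fun (H' : (LocChordal.cliqueIntersectionGraph G).Subgraph)
      (h : LocChordal.IsAcyclicFamily (LocChordal.coPart G H') 2) =>
    LocChordal.totalWeight_add_card (h.coPart_isAcyclic (by norm_num))
  rw [hcast]
  tfae_have 1 → 3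
  | ⟨hc, ha⟩ => by
    have h2 : LocChordal.IsAcyclicFamily (LocChordal.coPart G H) 2 :=
      fun X hX => ha X (hX.trans (by omega))
    have := (hbound H h2).2.2 hc.2.connected
    exact ⟨⟨hc.1, h2⟩, by omega⟩
  tfae_have 3 → 2
  | ⟨hs, hw⟩ => ⟨hs, fun H' hH' => by
      have := (hbound H' hH'.2).1
      omega⟩
  tfae_have 2 → 3
  | ⟨hs, hmax⟩ => by
    -- `H'` attains the upper bound, so a maximum-weight `H` attains it too.
    obtain ⟨H', hH', hconn⟩ := hG.exists_isAcyclicSpanning hr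
    have h1 := hmax H' hH'
    have h2 := (hbound H' hH'.2).2.2 hconn
    have h3 := (hbound H hs.2).1
    exact ⟨hs, by omega⟩
  tfae_have 3 → 1
  | ⟨hs, hw⟩ => by
    have hconn := (hbound H hs.2).2.1 (by omega)
    exact ⟨(LocChordal.isCliqueGraph_iff hs.1).2 hconn, hG.isAcyclicFamily_coPart hs.2 hconn⟩
  tfae_finish
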